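/- Let $PG$ be the Petersen graph, considered as a topological space in the usual way: it has the ten vertices $u_i,v_i$ $(i\in\mathbb{Z}/5)$ and the fifteen edges $u_iu_{i+1}$, $u_iv_i$, $v_iv_{i+2}$. A plane generic immersion of a finite graph $G$ is an immersion $f:G\to\mathbb{R}^2$ (a continuous, locally injective map) whose multiple points are only finitely many transversal double points between edges: the set of points of $\mathbb{R}^2$ with more than one preimage is finite, each such point has exactly two preimages, neither preimage is a vertex, and in suitable local topological coordinates of the plane the two branches of $f(G)$ at the point are the two coordinate axes. (Crossings of an edge with itself or with an adjacent edge are allowed.) The distance of two edges of $G$ is the minimum number of edges of a path of $G$ joining an end point of the one to an end point of the other, and $D_1(G)$ denotes the set of all unordered pairs $(d,e)$ of distinct edges of $G$ at distance $1$. Theorem. Let $f:PG\to\mathbb{R}^2$ be a plane generic immersion of the Petersen graph. Then \[ \sum_{(d,e)\in D_1(PG)}|f(d)\cap f(e)|\equiv 1\pmod 2 . \] -/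

import Mathlib

open Topology

namespace PlaneGraph

/-- The Euclidean plane. -/
abbrev Plane : Type := EuclideanSpace ℝ (Fin 2)

section Graph

variable {V : Type*} [DecidableEq V]

/-- The point of the geometric realization that corresponds to the vertex `v`:
the standard basis vector of `V → ℝ`. -/
def vertexPoint (v : V) : V → ℝ := Pi.single v 1

/-- The closed edge with end points `e`, as a subspace of `V → ℝ`: the straight segment that joins
the two end points of `e`. -/
def closedEdge (e : Sym2 V) : Set (V → ℝ) := convexHull ℝ (vertexPoint '' {v | v ∈ e})

/-- The geometric realization of a (finite) simple graph: the union of its vertices and its closed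
edges, a subspace of `V → ℝ`. This is the graph as a topological space in the usual way. -/
def realization (G : SimpleGraph V) : Set (V → ℝ) :=
  Set.range vertexPoint ∪ ⋃ e ∈ G.edgeSet, closedEdge e

/-- The two branches of `f` at the points `x` and `y`, where `f x = f y`, meet transversally: near
the common value there are local coordinates of the plane, centred at this value, in which `f` maps
a neighbourhood of `x` into the first axis and a neighbourhood of `y` into the second one. (For an
`f` that is continuous and locally injective near `x` and `y`, with `x` and `y` interior to edges,
the two branches then are neighbourhoods of the origin in the two axes.) -/
def MeetTransversally {X : Type*} [TopologicalSpace X] (f : X → Plane) (x y : X) : Prop :=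
  ∃ h : OpenPartialHomeomorph Plane Plane,
    f x ∈ h.source ∧ h (f x) = 0 ∧ (∀ᶠ z in 𝓝 x, h (f z) 1 = 0) ∧ (∀ᶠ z in 𝓝 y, h (f z) 0 = 0)

/-- A plane generic immersion of the graph `G`: an immersion (a continuous, locally injective map)
of the realization of `G` into the plane whose multiple points are only finitely many transversal
double points between edges. A crossing of an edge with itself or with an adjacent edge
is allowed. -/
structure IsPlaneGenericImmersion {G : SimpleGraph V} (f : realization G → Plane) : Prop where
  continuous : Continuous f
  locally_injective : IsLocallyInjective f
  /-- There are only finitely many multiple points. -/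
  finite_multiple : {p : Plane | ∃ x y, x ≠ y ∧ f x = p ∧ f y = p}.Finite
  /-- Every multiple point is a double point. -/
  double : ∀ x y z, f x = f y → f y = f z → x = y ∨ y = z ∨ x = z
  /-- No vertex is mapped to a multiple point. -/
  ne_vertex : ∀ x y, x ≠ y → f x = f y → ∀ v : V, (x : V → ℝ) ≠ vertexPoint v
  /-- Every double point is transversal. -/
  transversal : ∀ x y, x ≠ y → f x = f y → MeetTransversally f x y

/-- The image `f(e)` of the closed edge `e`. -/
def edgeImage {G : SimpleGraph V} (f : realization G → Plane) (e : Sym2 V) : Set Plane :=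
  f '' {x | (x : V → ℝ) ∈ closedEdge e}

/-- The number `|f(d) ∩ f(e)|`, for an unordered pair of edges `d` and `e`. -/
noncomputable def crossingCount {G : SimpleGraph V} (f : realization G → Plane) :
    Sym2 G.edgeSet → ℕ :=
  Sym2.lift ⟨fun d e => (edgeImage f d ∩ edgeImage f e).ncard,
    fun d e => congrArg Set.ncard (Set.inter_comm (edgeImage f d) (edgeImage f e))⟩

end Graph

section Distance

variable {V : Type*}

/-- The distance of two edges: the minimum number of edges of a path that joins
an end point of `d` to an end point of `e`. -/
noncomputable def edgeDist (G : SimpleGraph V) (d e : Sym2 V) : ℕ∞ :=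
  ⨅ (u ∈ d) (v ∈ e), G.edist u v

/-- The finite set `D_k(G)` of unordered pairs of distinct edges of `G` at distance `k`. -/
noncomputable def edgePairsAtDist (G : SimpleGraph V) [Finite V] (k : ℕ) :
    Finset (Sym2 G.edgeSet) :=
  (Set.toFinite {p : Sym2 G.edgeSet |
    ∃ d e : G.edgeSet, p = s(d, e) ∧ d ≠ e ∧ edgeDist G d e = k}).toFinset

end Distance

/-- The Petersen graph, with vertices `u i = Sum.inl i`, `v i = Sum.inr i` for `i` modulo 5, and
with the 15 edges `u i — u (i + 1)`, `u i — v i`, `v i — v (i + 2)`. -/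
def petersen : SimpleGraph (ZMod 5 ⊕ ZMod 5) :=
  SimpleGraph.fromRel fun
    | Sum.inl i, Sum.inl j => j = i + 1
    | Sum.inl i, Sum.inr j => j = i
    | Sum.inr i, Sum.inr j => j = i + 2
    | Sum.inr _, Sum.inl _ => False

end PlaneGraph

/-! For two disjoint edges with images parametrized by α and β, the crossings are the zeros of F(s,
t) = α(s) - β(t) on the unit square. A transversal crossing has odd local index
(`hasOddIndex_of_transversal`), so the number of crossings has the parity of the winding number of F
along the boundary (`winding_eq_ncard`). Each side of the square pairs one edge with one end point
of the other. Fixing logarithms of the differences of vertex images therefore splits the winding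
number into four integers that each depend on an edge and a vertex only, and a corner term that
depends only on an ordering of the vertices (`exists_crossing_parity`).

In the sum over the pairs at distance 1, the integer of an edge e and a vertex v occurs once for
each edge at distance 1 from e that ends at v. In the Petersen graph this number is always even, so
these integers cancel modulo 2 (`sum_petersenDistOne_ends`) and the parity is the same for all
immersions. The corner terms that remain count the crossings of a straight-line drawing with the
vertices in convex position; a finite check shows that their sum is odd (`sum_descents_petersen`).
-/

namespace PlaneGraph

open Set Complex

/-! ### Change of a continuous logarithm along a path -/

/-- The retraction of the real line onto the interval with end points `a` and `b`. -/
def clamp (a b t : ℝ) : ℝ := max (min a b) (min t (max a b))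

lemma continuous_clamp (a b : ℝ) : Continuous (clamp a b) := by
  unfold clamp; fun_prop

lemma clamp_mem (a b t : ℝ) : clamp a b t ∈ uIcc a b := by
  have : min a b ≤ max a b := min_le_max
  simp only [clamp, uIcc, mem_Icc]
  exact ⟨le_max_left _ _, max_le this (min_le_right _ _)⟩

lemma clamp_of_mem {a b t : ℝ} (h : t ∈ uIcc a b) : clamp a b t = t := by
  rw [clamp, min_eq_left h.2, max_eq_right h.1]

/-- Composing with the retraction `clamp` in each coordinate extends F without zeros to the whole
plane, which is simply connected, so the extension lifts through `exp`. -/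
lemma exists_continuous_log_prod {F : ℝ × ℝ → ℂ} {a b c d : ℝ}
    (hF : ContinuousOn F (uIcc a b ×ˢ uIcc c d)) (h0 : ∀ p ∈ uIcc a b ×ˢ uIcc c d, F p ≠ 0) :
    ∃ L : ℝ × ℝ → ℂ, Continuous L ∧ ∀ p ∈ uIcc a b ×ˢ uIcc c d, exp (L p) = F p := by
  let r : ℝ × ℝ → ℝ × ℝ := fun p ↦ (clamp a b p.1, clamp c d p.2)
  have hr : Continuous r :=
    ((continuous_clamp a b).comp continuous_fst).prodMk ((continuous_clamp c d).comp continuous_snd)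
  have hrm : ∀ p, r p ∈ uIcc a b ×ˢ uIcc c d := fun p ↦ ⟨clamp_mem _ _ _, clamp_mem _ _ _⟩
  have hu : IsSimplyConnected (univ : Set (ℝ × ℝ)) := by
    have := (Homeomorph.Set.univ (ℝ × ℝ)).contractibleSpace
    exact SimplyConnectedSpace.ofContractible _
  obtain ⟨L, hLc, hL⟩ := exists_continuousOn_eqOn_exp_comp hu isOpen_univ
    (g := F ∘ r) (hF.comp_continuous hr hrm).continuousOn (by
      rintro ⟨p, -, hp⟩
      exact h0 _ (hrm p) hp)
  refine ⟨L, continuousOn_univ.1 hLc, fun p hp ↦ ?_⟩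
  have := hL (mem_univ p)
  simpa [r, clamp_of_mem hp.1, clamp_of_mem hp.2] using this

lemma exists_continuous_log {γ : ℝ → ℂ} {a b : ℝ}
    (hγ : ContinuousOn γ (uIcc a b)) (h0 : ∀ t ∈ uIcc a b, γ t ≠ 0) :
    ∃ L : ℝ → ℂ, ContinuousOn L (uIcc a b) ∧ ∀ t ∈ uIcc a b, exp (L t) = γ t := by
  obtain ⟨L, hL, h⟩ := exists_continuous_log_prod (F := fun p ↦ γ p.1) (a := a) (b := b) (c := 0)
    (d := 0) (hγ.comp continuous_fst.continuousOn fun p hp ↦ hp.1) (fun p hp ↦ h0 _ hp.1)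
  exact ⟨fun t ↦ L (t, 0), (hL.comp (by fun_prop)).continuousOn,
    fun t ht ↦ h (t, 0) ⟨ht, by simp⟩⟩

open Classical in
/-- The change from `a` to `b` of a continuous logarithm of `γ`. -/
noncomputable def logChange (γ : ℝ → ℂ) (a b : ℝ) : ℂ :=
  if h : ∃ L : ℝ → ℂ, ContinuousOn L (uIcc a b) ∧ ∀ t ∈ uIcc a b, exp (L t) = γ t then
    h.choose b - h.choose a else 0

/-- (L - M) / 2πi is continuous with integer values on an interval, hence constant. This makes
`logChange` independent of the chosen logarithm. -/
lemma sub_eq_sub_of_exp_eq {L M : ℝ → ℂ} {a b : ℝ} (hL : ContinuousOn L (uIcc a b))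
    (hM : ContinuousOn M (uIcc a b)) (h : ∀ t ∈ uIcc a b, exp (L t) = exp (M t)) :
    L b - L a = M b - M a := by
  have key : ∀ t ∈ uIcc a b, ∃ n : ℤ, ((L t - M t) / (2 * Real.pi * I)).re = n ∧
      L t - M t = n * (2 * Real.pi * I) := by
    intro t ht
    obtain ⟨n, hn⟩ := exp_eq_exp_iff_exists_int.1 (h t ht)
    have : L t - M t = n * (2 * Real.pi * I) := by rw [hn]; ring
    refine ⟨n, ?_, this⟩
    rw [this, mul_div_assoc, div_self two_pi_I_ne_zero]
    simp
  have hc : ContinuousOn (fun t ↦ ((L t - M t) / (2 * Real.pi * I)).re) (uIcc a b) :=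
    continuous_re.comp_continuousOn ((hL.sub hM).div_const _)
  obtain ⟨m, hm, hm'⟩ := key a left_mem_uIcc
  obtain ⟨n, hn, hn'⟩ := key b right_mem_uIcc
  have hmem : MapsTo (fun t ↦ ((L t - M t) / (2 * Real.pi * I)).re) (uIcc a b)
      (range ((↑) : ℤ → ℝ)) := fun t ht ↦ by
    obtain ⟨k, hk, -⟩ := key t ht
    exact ⟨k, hk.symm⟩
  have hdisc : IsDiscrete (range ((↑) : ℤ → ℝ)) :=
    ⟨Int.isClosedEmbedding_coe_real.isEmbedding.toHomeomorph.symm.isEmbedding.discreteTopology⟩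
  have heq := isPreconnected_uIcc.constant_of_mapsTo hdisc hc hmem
    (left_mem_uIcc (a := a) (b := b)) right_mem_uIcc
  simp only [hm, hn] at heq
  have : m = n := by exact_mod_cast heq
  subst this
  linear_combination hn' - hm'

lemma logChange_eq {γ L : ℝ → ℂ} {a b : ℝ} (hL : ContinuousOn L (uIcc a b))
    (h : ∀ t ∈ uIcc a b, exp (L t) = γ t) : logChange γ a b = L b - L a := by
  have hex : ∃ L : ℝ → ℂ, ContinuousOn L (uIcc a b) ∧ ∀ t ∈ uIcc a b, exp (L t) = γ t := ⟨L, hL, h⟩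
  rw [logChange, dif_pos hex]
  exact sub_eq_sub_of_exp_eq hex.choose_spec.1 hL
    fun t ht ↦ (hex.choose_spec.2 t ht).trans (h t ht).symm

lemma exp_logChange {γ : ℝ → ℂ} {a b : ℝ} (hγ : ContinuousOn γ (uIcc a b))
    (h0 : ∀ t ∈ uIcc a b, γ t ≠ 0) : exp (logChange γ a b) = γ b / γ a := by
  obtain ⟨L, hL, h⟩ := exists_continuous_log hγ h0
  rw [logChange_eq hL h, exp_sub, h _ left_mem_uIcc, h _ right_mem_uIcc]

lemma logChange_congr {γ δ : ℝ → ℂ} {a b : ℝ} (h : EqOn γ δ (uIcc a b)) :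
    logChange γ a b = logChange δ a b := by
  have : ∀ L : ℝ → ℂ, (ContinuousOn L (uIcc a b) ∧ ∀ t ∈ uIcc a b, exp (L t) = γ t) ↔
      (ContinuousOn L (uIcc a b) ∧ ∀ t ∈ uIcc a b, exp (L t) = δ t) := fun L ↦
    and_congr_right fun _ ↦ forall₂_congr fun t ht ↦ by rw [h ht]
  by_cases hex : ∃ L : ℝ → ℂ, ContinuousOn L (uIcc a b) ∧ ∀ t ∈ uIcc a b, exp (L t) = γ t
  · obtain ⟨L, hL⟩ := hex
    rw [logChange_eq hL.1 hL.2, logChange_eq hL.1 ((this L).1 hL).2]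
  · rw [logChange, dif_neg hex, logChange, dif_neg (by simpa only [this] using hex)]

lemma logChange_add {γ : ℝ → ℂ} {a b c : ℝ} (hab : a ≤ b) (hbc : b ≤ c)
    (hγ : ContinuousOn γ (Icc a c)) (h0 : ∀ t ∈ Icc a c, γ t ≠ 0) :
    logChange γ a c = logChange γ a b + logChange γ b c := by
  rw [← uIcc_of_le (hab.trans hbc)] at hγ h0
  obtain ⟨L, hL, h⟩ := exists_continuous_log hγ h0
  have h1 : uIcc a b ⊆ uIcc a c := by
    rw [uIcc_of_le hab, uIcc_of_le (hab.trans hbc)]; exact Icc_subset_Icc_right hbc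
  have h2 : uIcc b c ⊆ uIcc a c := by
    rw [uIcc_of_le hbc, uIcc_of_le (hab.trans hbc)]; exact Icc_subset_Icc_left hab
  rw [logChange_eq hL h, logChange_eq (hL.mono h1) fun t ht ↦ h t (h1 ht),
    logChange_eq (hL.mono h2) fun t ht ↦ h t (h2 ht)]
  ring

lemma logChange_symm {γ : ℝ → ℂ} {a b : ℝ} (hγ : ContinuousOn γ (uIcc a b))
    (h0 : ∀ t ∈ uIcc a b, γ t ≠ 0) : logChange γ b a = -logChange γ a b := by
  obtain ⟨L, hL, h⟩ := exists_continuous_log hγ h0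
  rw [logChange_eq hL h, logChange_eq (by rwa [uIcc_comm]) (by rwa [uIcc_comm])]
  ring

lemma logChange_neg {γ : ℝ → ℂ} {a b : ℝ} (hγ : ContinuousOn γ (uIcc a b))
    (h0 : ∀ t ∈ uIcc a b, γ t ≠ 0) : logChange (fun t ↦ -γ t) a b = logChange γ a b := by
  obtain ⟨L, hL, h⟩ := exists_continuous_log hγ h0
  rw [logChange_eq hL h, logChange_eq (L := fun t ↦ L t + Real.pi * I) (by fun_prop)
    (fun t ht ↦ by rw [exp_add, h t ht, exp_pi_mul_I]; ring)]
  ring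

lemma logChange_comp {γ : ℝ → ℂ} {φ : ℝ → ℝ} {a b : ℝ} (hφ : ContinuousOn φ (uIcc a b))
    (hm : MapsTo φ (uIcc a b) (uIcc (φ a) (φ b))) (hγ : ContinuousOn γ (uIcc (φ a) (φ b)))
    (h0 : ∀ t ∈ uIcc (φ a) (φ b), γ t ≠ 0) :
    logChange (fun t ↦ γ (φ t)) a b = logChange γ (φ a) (φ b) := by
  obtain ⟨L, hL, h⟩ := exists_continuous_log hγ h0
  rw [logChange_eq hL h, logChange_eq (L := L ∘ φ) (hL.comp hφ hm) fun t ht ↦ h _ (hm ht)]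
  rfl

/-! ### Winding of a map along the boundary of a rectangle -/

/-- The change of a continuous logarithm of `F` along the boundary of the rectangle with opposite
corners `(a, c)` and `(b, d)`. -/
noncomputable def winding (F : ℝ → ℝ → ℂ) (a b c d : ℝ) : ℂ :=
  logChange (fun s ↦ F s c) a b + logChange (fun t ↦ F b t) c d
    - logChange (fun s ↦ F s d) a b - logChange (fun t ↦ F a t) c d

/-- A single logarithm exists on the whole rectangle, and its changes along the four sides
telescope. -/
lemma winding_eq_zero {F : ℝ → ℝ → ℂ} {a b c d : ℝ}
    (hF : ContinuousOn (Function.uncurry F) (uIcc a b ×ˢ uIcc c d))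
    (h0 : ∀ s ∈ uIcc a b, ∀ t ∈ uIcc c d, F s t ≠ 0) : winding F a b c d = 0 := by
  obtain ⟨L, hL, h⟩ := exists_continuous_log_prod hF fun p hp ↦ h0 p.1 hp.1 p.2 hp.2
  have hs : ∀ t ∈ uIcc c d, logChange (fun s ↦ F s t) a b = L (b, t) - L (a, t) := fun t ht ↦
    logChange_eq (L := fun s ↦ L (s, t)) (by fun_prop) fun s hs ↦ h (s, t) ⟨hs, ht⟩
  have ht : ∀ s ∈ uIcc a b, logChange (fun t ↦ F s t) c d = L (s, d) - L (s, c) := fun s hs ↦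
    logChange_eq (L := fun t ↦ L (s, t)) (by fun_prop) fun t ht ↦ h (s, t) ⟨hs, ht⟩
  rw [winding, hs _ left_mem_uIcc, hs _ right_mem_uIcc, ht _ left_mem_uIcc, ht _ right_mem_uIcc]
  ring

/-- The common side enters with both signs and cancels, so zeros need to be excluded only on the two
sides that are cut. -/
lemma winding_add_left {F : ℝ → ℝ → ℂ} {a b c d m : ℝ} (hF : Continuous (Function.uncurry F))
    (ham : a ≤ m) (hmb : m ≤ b) (h0 : ∀ s ∈ Icc a b, F s c ≠ 0) (h1 : ∀ s ∈ Icc a b, F s d ≠ 0) :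
    winding F a b c d = winding F a m c d + winding F m b c d := by
  have hc : ∀ t, Continuous fun s ↦ F s t := fun t ↦ hF.comp (f := fun s ↦ (s, t)) (by fun_prop)
  rw [winding, winding, winding, logChange_add ham hmb (hc c).continuousOn h0,
    logChange_add ham hmb (hc d).continuousOn h1]
  ring

lemma winding_add_right {F : ℝ → ℝ → ℂ} {a b c d m : ℝ} (hF : Continuous (Function.uncurry F))
    (hcm : c ≤ m) (hmd : m ≤ d) (h0 : ∀ t ∈ Icc c d, F a t ≠ 0) (h1 : ∀ t ∈ Icc c d, F b t ≠ 0) :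
    winding F a b c d = winding F a b c m + winding F a b m d := by
  have hc : ∀ s, Continuous fun t ↦ F s t := fun s ↦ hF.comp (f := fun t ↦ (s, t)) (by fun_prop)
  rw [winding, winding, winding, logChange_add hcm hmd (hc a).continuousOn h0,
    logChange_add hcm hmd (hc b).continuousOn h1]
  ring

/-- Invariance of the winding under a homotopy that has no zeros along the boundary. -/
lemma winding_eq_of_homotopy {K : ℝ → ℝ → ℝ → ℂ} {a b c d : ℝ}
    (hK : ContinuousOn (fun p : ℝ × ℝ × ℝ ↦ K p.1 p.2.1 p.2.2)
      (uIcc 0 1 ×ˢ uIcc a b ×ˢ uIcc c d))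
    (h0 : ∀ τ ∈ uIcc (0 : ℝ) 1, ∀ s ∈ uIcc a b, ∀ t ∈ uIcc c d,
      (s = a ∨ s = b ∨ t = c ∨ t = d) → K τ s t ≠ 0) :
    winding (K 0) a b c d = winding (K 1) a b c d := by
  -- Each side of the rectangle sweeps out a zero-free rectangle in the time τ. In the alternating
  -- sum of these four vanishing windings the paths of the corners cancel.
  have hs : ∀ t ∈ uIcc c d, (t = c ∨ t = d) → winding (fun τ s ↦ K τ s t) 0 1 a b = 0 := by
    intro t ht htcd
    refine winding_eq_zero (hK.comp (f := fun p : ℝ × ℝ ↦ (p.1, p.2, t)) (by fun_prop)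
      fun p hp ↦ ⟨hp.1, hp.2, ht⟩) fun τ hτ s hs ↦ h0 τ hτ s hs t ht (by tauto)
  have ht : ∀ s ∈ uIcc a b, (s = a ∨ s = b) → winding (fun τ t ↦ K τ s t) 0 1 c d = 0 := by
    intro s hs hsab
    refine winding_eq_zero (hK.comp (f := fun p : ℝ × ℝ ↦ (p.1, s, p.2)) (by fun_prop)
      fun p hp ↦ ⟨hp.1, hs, hp.2⟩) fun τ hτ t ht ↦ h0 τ hτ s hs t ht (by tauto)
  have h1 := hs c left_mem_uIcc (by simp)
  have h2 := hs d right_mem_uIcc (by simp)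
  have h3 := ht a left_mem_uIcc (by simp)
  have h4 := ht b right_mem_uIcc (by simp)
  simp only [winding] at *
  linear_combination -h1 + h2 + h3 - h4

/-- The winding of an odd map along the boundary of a rectangle centred at the origin is odd. -/
lemma winding_of_odd {G : ℝ → ℝ → ℂ} {r q : ℝ}
    (hG : ContinuousOn (Function.uncurry G) (uIcc (-r) r ×ˢ uIcc (-q) q))
    (h0 : ∀ s ∈ uIcc (-r) r, ∀ t ∈ uIcc (-q) q, (s = -r ∨ s = r ∨ t = -q ∨ t = q) → G s t ≠ 0)
    (hodd : ∀ s t, G (-s) (-t) = -G s t) :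
    ∃ k : ℤ, winding G (-r) r (-q) q = (2 * k + 1) * (2 * Real.pi * I) := by
  have hs : ContinuousOn (fun s ↦ G s (-q)) (uIcc (-r) r) :=
    hG.comp (f := fun s ↦ (s, -q)) (by fun_prop) fun s hs ↦ ⟨hs, left_mem_uIcc⟩
  have ht : ContinuousOn (fun t ↦ G r t) (uIcc (-q) q) :=
    hG.comp (f := fun t ↦ (r, t)) (by fun_prop) fun t ht ↦ ⟨right_mem_uIcc, ht⟩
  have hs0 : ∀ s ∈ uIcc (-r) r, G s (-q) ≠ 0 := fun s hs ↦ h0 s hs _ left_mem_uIcc (by simp)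
  have ht0 : ∀ t ∈ uIcc (-q) q, G r t ≠ 0 := fun t ht ↦ h0 _ right_mem_uIcc t ht (by simp)
  have hneg : ∀ x : ℝ, MapsTo (fun t ↦ -t) (uIcc (-x) x) (uIcc (-x) x) := by
    intro x t ht
    rw [mem_uIcc] at *
    rcases ht with ht | ht
    · left; constructor <;> linarith
    · right; constructor <;> linarith
  have e1 : logChange (fun s ↦ G s q) (-r) r = -logChange (fun s ↦ G s (-q)) (-r) r := by
    rw [← logChange_symm hs hs0]
    have := logChange_comp (γ := fun s ↦ G s (-q)) (φ := fun s ↦ -s) (a := -r) (b := r)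
      (by fun_prop) (by simpa [uIcc_comm] using hneg r) (by simpa [uIcc_comm] using hs)
      (by simpa [uIcc_comm] using hs0)
    simp only [neg_neg] at this
    rw [← this, ← logChange_neg]
    · refine logChange_congr fun s _ ↦ ?_
      rw [← hodd]
    · exact hG.comp (f := fun s ↦ (s, q)) (by fun_prop) fun s hs ↦ ⟨hs, right_mem_uIcc⟩
    · exact fun s hs ↦ h0 s hs _ right_mem_uIcc (by simp)
  have e2 : logChange (fun t ↦ G (-r) t) (-q) q = -logChange (fun t ↦ G r t) (-q) q := by
    rw [← logChange_symm ht ht0]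
    have := logChange_comp (γ := fun t ↦ G r t) (φ := fun s ↦ -s) (a := -q) (b := q)
      (by fun_prop) (by simpa [uIcc_comm] using hneg q) (by simpa [uIcc_comm] using ht)
      (by simpa [uIcc_comm] using ht0)
    simp only [neg_neg] at this
    rw [← this, ← logChange_neg]
    · refine logChange_congr fun s _ ↦ ?_
      rw [← hodd, neg_neg]
    · exact hG.comp (f := fun s ↦ (-r, s)) (by fun_prop) fun s hs ↦ ⟨left_mem_uIcc, hs⟩
    · exact fun s hs ↦ h0 _ left_mem_uIcc s hs (by simp)
  -- Half of the boundary leads from the corner (-r, -q) to its antipode, where G has the opposite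
  -- value. The logarithm thus changes by an odd multiple of πi, and the other half of the boundary
  -- doubles this.
  have hexp : exp (logChange (fun s ↦ G s (-q)) (-r) r + logChange (fun t ↦ G r t) (-q) q)
      = exp (Real.pi * I) := by
    have hodd' := hodd r q
    have hne := h0 r right_mem_uIcc q right_mem_uIcc (by simp)
    have hne' := h0 r right_mem_uIcc (-q) left_mem_uIcc (by simp)
    rw [exp_add, exp_logChange hs hs0, exp_logChange ht ht0, exp_pi_mul_I, hodd']
    field_simp
  obtain ⟨k, hk⟩ := exp_eq_exp_iff_exists_int.1 hexp
  refine ⟨k, ?_⟩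
  rw [winding, e1, e2]
  linear_combination 2 * hk

lemma abs_lt_of_mem_uIcc_neg {x u ε : ℝ} (hx : |x| < ε) (hu : u ∈ uIcc (-x) x) : |u| < ε := by
  refine lt_of_le_of_lt ?_ hx
  rw [mem_uIcc] at hu
  rcases hu with hu | hu
  · exact abs_le.2 ⟨by linarith [le_abs_self x], by linarith [le_abs_self x]⟩
  · exact abs_le.2 ⟨by linarith [neg_abs_le x], by linarith [neg_abs_le x]⟩

/-- The difference of the two branches of an injective map along the axes has odd winding
around the origin. -/
lemma winding_axes {g : ℝ × ℝ → ℂ} {ε r q : ℝ} (hg : ContinuousOn g (Metric.ball 0 ε))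
    (hi : InjOn g (Metric.ball 0 ε)) (hr : |r| < ε) (hq : |q| < ε) (hr0 : r ≠ 0) (hq0 : q ≠ 0) :
    ∃ k : ℤ, winding (fun u v ↦ g (u, 0) - g (0, v)) (-r) r (-q) q
      = (2 * k + 1) * (2 * Real.pi * I) := by
  have hu' : ∀ u ∈ uIcc (-r) r, |u| < ε := fun u hu ↦ abs_lt_of_mem_uIcc_neg hr hu
  have hv' : ∀ v ∈ uIcc (-q) q, |v| < ε := fun v hv ↦ abs_lt_of_mem_uIcc_neg hq hv
  have hball : ∀ u v : ℝ, |u| < ε → |v| < ε → (u, v) ∈ Metric.ball (0 : ℝ × ℝ) ε := by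
    intro u v hu hv
    simp [Prod.norm_def, hu, hv]
  have hmul : ∀ {x c : ℝ}, |x| < ε → |c| ≤ 1 → |c * x| < ε := by
    intro x c hx hc
    rw [abs_mul]
    exact lt_of_le_of_lt (mul_le_of_le_one_left (abs_nonneg x) hc) hx
  -- The arguments of the two values of g always differ by (u, -v), so injectivity keeps K nonzero
  -- away from the origin. At τ = 1 they are (u/2, -v/2) and its negative, which makes K odd.
  let K : ℝ → ℝ → ℝ → ℂ := fun τ u v ↦
    g ((1 - τ / 2) * u, (-(τ / 2)) * v) - g ((-(τ / 2)) * u, (1 - τ / 2) * v)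
  have hτ1 : ∀ τ ∈ uIcc (0 : ℝ) 1, |1 - τ / 2| ≤ 1 := fun τ hτ ↦ by
    rw [uIcc_of_le zero_le_one] at hτ
    exact abs_le.2 ⟨by linarith [hτ.2], by linarith [hτ.1]⟩
  have hτ2 : ∀ τ ∈ uIcc (0 : ℝ) 1, |-(τ / 2)| ≤ 1 := fun τ hτ ↦ by
    rw [uIcc_of_le zero_le_one] at hτ
    exact abs_le.2 ⟨by linarith [hτ.2], by linarith [hτ.1]⟩
  have hK : ContinuousOn (fun p : ℝ × ℝ × ℝ ↦ K p.1 p.2.1 p.2.2)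
      (uIcc 0 1 ×ˢ uIcc (-r) r ×ˢ uIcc (-q) q) := by
    refine (hg.comp (f := fun p : ℝ × ℝ × ℝ ↦ ((1 - p.1 / 2) * p.2.1, (-(p.1 / 2)) * p.2.2))
      (by fun_prop) ?_).sub
      (hg.comp (f := fun p : ℝ × ℝ × ℝ ↦ ((-(p.1 / 2)) * p.2.1, (1 - p.1 / 2) * p.2.2))
      (by fun_prop) ?_)
    · rintro ⟨τ, u, v⟩ ⟨hτ, hu, hv⟩
      exact hball _ _ (hmul (hu' u hu) (hτ1 τ hτ)) (hmul (hv' v hv) (hτ2 τ hτ))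
    · rintro ⟨τ, u, v⟩ ⟨hτ, hu, hv⟩
      exact hball _ _ (hmul (hu' u hu) (hτ2 τ hτ)) (hmul (hv' v hv) (hτ1 τ hτ))
  have hK0 : ∀ τ ∈ uIcc (0 : ℝ) 1, ∀ s ∈ uIcc (-r) r, ∀ t ∈ uIcc (-q) q,
      (s = -r ∨ s = r ∨ t = -q ∨ t = q) → K τ s t ≠ 0 := by
    intro τ hτ u hu v hv hb h
    have := hi (hball _ _ (hmul (hu' u hu) (hτ1 τ hτ)) (hmul (hv' v hv) (hτ2 τ hτ)))
      (hball _ _ (hmul (hu' u hu) (hτ2 τ hτ)) (hmul (hv' v hv) (hτ1 τ hτ))) (sub_eq_zero.1 h)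
    simp only [Prod.mk.injEq] at this
    have hu0 : u = 0 := by linarith [this.1]
    have hv0 : v = 0 := by linarith [this.2]
    subst hu0 hv0
    rcases hb with h | h | h | h
    · exact hr0 (by linarith)
    · exact hr0 h.symm
    · exact hq0 (by linarith)
    · exact hq0 h.symm
  have h1 : winding (K 0) (-r) r (-q) q
      = winding (fun u v ↦ g (u, 0) - g (0, v)) (-r) r (-q) q := by
    simp [K]
  rw [← h1, winding_eq_of_homotopy hK hK0]
  refine winding_of_odd
    (hK.comp (f := fun p : ℝ × ℝ ↦ ((1 : ℝ), p.1, p.2)) (by fun_prop)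
      fun p hp ↦ ⟨right_mem_uIcc, hp.1, hp.2⟩) (hK0 1 right_mem_uIcc) fun s t ↦ ?_
  simp only [K]
  norm_num

lemma winding_congr {F G : ℝ → ℝ → ℂ} {a b c d : ℝ}
    (h : ∀ s ∈ uIcc a b, ∀ t ∈ uIcc c d, F s t = G s t) :
    winding F a b c d = winding G a b c d := by
  have hs : ∀ t ∈ uIcc c d, logChange (fun s ↦ F s t) a b = logChange (fun s ↦ G s t) a b :=
    fun t ht ↦ logChange_congr fun s hs ↦ h s hs t ht
  have ht : ∀ s ∈ uIcc a b, logChange (fun t ↦ F s t) c d = logChange (fun t ↦ G s t) c d :=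
    fun s hs ↦ logChange_congr fun t ht ↦ h s hs t ht
  simp only [winding, hs _ left_mem_uIcc, hs _ right_mem_uIcc, ht _ left_mem_uIcc,
    ht _ right_mem_uIcc]

/-- Only the end values of a reparametrization matter. It may reverse direction, which is why
unordered intervals are used. -/
lemma winding_comp {G : ℝ → ℝ → ℂ} {φ ψ : ℝ → ℝ} {a b c d : ℝ}
    (hφ : ContinuousOn φ (uIcc a b)) (hφm : MapsTo φ (uIcc a b) (uIcc (φ a) (φ b)))
    (hψ : ContinuousOn ψ (uIcc c d)) (hψm : MapsTo ψ (uIcc c d) (uIcc (ψ c) (ψ d)))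
    (hG : ContinuousOn (Function.uncurry G) (uIcc (φ a) (φ b) ×ˢ uIcc (ψ c) (ψ d)))
    (h0 : ∀ s ∈ uIcc (φ a) (φ b), ∀ t ∈ uIcc (ψ c) (ψ d),
      (s = φ a ∨ s = φ b ∨ t = ψ c ∨ t = ψ d) → G s t ≠ 0) :
    winding (fun s t ↦ G (φ s) (ψ t)) a b c d = winding G (φ a) (φ b) (ψ c) (ψ d) := by
  have hs : ∀ t ∈ uIcc (ψ c) (ψ d), (t = ψ c ∨ t = ψ d) →
      logChange (fun s ↦ G (φ s) t) a b = logChange (fun s ↦ G s t) (φ a) (φ b) :=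
    fun t ht htcd ↦ logChange_comp hφ hφm
      (hG.comp (f := fun s ↦ (s, t)) (by fun_prop) fun s hs ↦ ⟨hs, ht⟩)
      fun s hs ↦ h0 s hs t ht (by tauto)
  have ht : ∀ s ∈ uIcc (φ a) (φ b), (s = φ a ∨ s = φ b) →
      logChange (fun t ↦ G s (ψ t)) c d = logChange (fun t ↦ G s t) (ψ c) (ψ d) :=
    fun s hs hsab ↦ logChange_comp hψ hψm
      (hG.comp (f := fun t ↦ (s, t)) (by fun_prop) fun t ht ↦ ⟨hs, ht⟩)
      fun t ht ↦ h0 s hs t ht (by tauto)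
  rw [winding, winding, hs _ left_mem_uIcc (by simp), hs _ right_mem_uIcc (by simp),
    ht _ left_mem_uIcc (by simp), ht _ right_mem_uIcc (by simp)]

/-! ### Counting zeros by the winding -/

/-- The point `p` is surrounded by arbitrarily small rectangles along whose boundaries `F` has odd
winding. -/
def HasOddIndex (F : ℝ → ℝ → ℂ) (p : ℝ × ℝ) : Prop :=
  ∀ δ > 0, ∃ s₁ s₂ t₁ t₂ : ℝ, s₁ ∈ Ioo (p.1 - δ) p.1 ∧ s₂ ∈ Ioo p.1 (p.1 + δ) ∧
    t₁ ∈ Ioo (p.2 - δ) p.2 ∧ t₂ ∈ Ioo p.2 (p.2 + δ) ∧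
    ∃ k : ℤ, winding F s₁ s₂ t₁ t₂ = (2 * k + 1) * (2 * Real.pi * I)

/-- The small rectangle is cut out of the large one by two vertical and two horizontal cuts; the
four pieces around it contain no zero. -/
lemma winding_eq_of_unique_zero {F : ℝ → ℝ → ℂ} (hF : Continuous (Function.uncurry F))
    {a b c d s₁ s₂ t₁ t₂ : ℝ} {p : ℝ × ℝ} (has : a ≤ s₁) (hs₁ : s₁ < p.1) (hs₂ : p.1 < s₂)
    (hsb : s₂ ≤ b) (hct : c ≤ t₁) (ht₁ : t₁ < p.2) (ht₂ : p.2 < t₂) (htd : t₂ ≤ d)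
    (h : ∀ s ∈ Icc a b, ∀ t ∈ Icc c d, F s t = 0 → s = p.1 ∧ t = p.2)
    (hs : ∀ s ∈ Icc a b, F s c ≠ 0 ∧ F s d ≠ 0) :
    winding F a b c d = winding F s₁ s₂ t₁ t₂ := by
  have hne : ∀ s t, s ∈ Icc a b → t ∈ Icc c d → (s ≠ p.1 ∨ t ≠ p.2) → F s t ≠ 0 :=
    fun s t hs ht hst h0 ↦ by
      have := h s hs t ht h0
      tauto
  have e1 : winding F a b c d = winding F a s₁ c d + winding F s₁ b c d :=
    winding_add_left hF has (by linarith) (fun s h ↦ (hs s h).1) (fun s h ↦ (hs s h).2)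
  have e2 : winding F s₁ b c d = winding F s₁ s₂ c d + winding F s₂ b c d :=
    winding_add_left hF (by linarith) hsb (fun s h ↦ (hs s ⟨has.trans h.1, h.2⟩).1)
      (fun s h ↦ (hs s ⟨has.trans h.1, h.2⟩).2)
  have e3 : winding F s₁ s₂ c d = winding F s₁ s₂ c t₁ + winding F s₁ s₂ t₁ d :=
    winding_add_right hF hct (by linarith)
      (fun t ht ↦ hne _ _ ⟨has, by linarith⟩ ht (.inl hs₁.ne))
      (fun t ht ↦ hne _ _ ⟨by linarith, hsb⟩ ht (.inl hs₂.ne'))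
  have e4 : winding F s₁ s₂ t₁ d = winding F s₁ s₂ t₁ t₂ + winding F s₁ s₂ t₂ d :=
    winding_add_right hF (by linarith) htd
      (fun t ht ↦ hne _ _ ⟨has, by linarith⟩ ⟨hct.trans ht.1, ht.2⟩ (.inl hs₁.ne))
      (fun t ht ↦ hne _ _ ⟨by linarith, hsb⟩ ⟨hct.trans ht.1, ht.2⟩ (.inl hs₂.ne'))
  have z1 : winding F a s₁ c d = 0 := by
    refine winding_eq_zero hF.continuousOn fun s hs t ht ↦ ?_
    rw [uIcc_of_le (by linarith)] at hs ht
    exact hne s t ⟨hs.1, by linarith [hs.2]⟩ ht (.inl (by linarith [hs.2] : s < p.1).ne)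
  have z2 : winding F s₂ b c d = 0 := by
    refine winding_eq_zero hF.continuousOn fun s hs t ht ↦ ?_
    rw [uIcc_of_le (by linarith)] at hs ht
    exact hne s t ⟨by linarith [hs.1], hs.2⟩ ht (.inl (by linarith [hs.1] : p.1 < s).ne')
  have z3 : winding F s₁ s₂ c t₁ = 0 := by
    refine winding_eq_zero hF.continuousOn fun s hs t ht ↦ ?_
    rw [uIcc_of_le (by linarith)] at hs ht
    exact hne s t ⟨by linarith [hs.1], by linarith [hs.2]⟩ ⟨ht.1, by linarith [ht.2]⟩
      (.inr (by linarith [ht.2] : t < p.2).ne)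
  have z4 : winding F s₁ s₂ t₂ d = 0 := by
    refine winding_eq_zero hF.continuousOn fun s hs t ht ↦ ?_
    rw [uIcc_of_le (by linarith)] at hs ht
    exact hne s t ⟨by linarith [hs.1], by linarith [hs.2]⟩ ⟨by linarith [ht.1], ht.2⟩
      (.inr (by linarith [ht.1] : p.2 < t).ne')
  rw [e1, e2, e3, e4, z1, z2, z3, z4]
  ring

/-- If all zeros of `F` in a rectangle have odd index, then their number is congruent modulo two to
the winding number of `F` along the boundary. -/
lemma winding_eq_card_zeros {F : ℝ → ℝ → ℂ} (hF : Continuous (Function.uncurry F)) {c d : ℝ}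
    (hcd : c ≤ d) :
    ∀ (n : ℕ) {a b : ℝ} (Z : Finset (ℝ × ℝ)), Z.card = n → a ≤ b →
    (∀ p, p ∈ Z ↔ p.1 ∈ Icc a b ∧ p.2 ∈ Icc c d ∧ F p.1 p.2 = 0) →
    (∀ s ∈ Icc a b, F s c ≠ 0 ∧ F s d ≠ 0) → (∀ t ∈ Icc c d, F a t ≠ 0 ∧ F b t ≠ 0) →
    InjOn Prod.fst (Z : Set (ℝ × ℝ)) → (∀ p ∈ Z, HasOddIndex F p) →
    ∃ k : ℤ, winding F a b c d = k * (2 * Real.pi * I) ∧ (k : ZMod 2) = n := by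
  intro n
  induction n using Nat.strong_induction_on with
  | _ n ih =>
  intro a b Z hn hab hZ hs ht hinj hodd
  rcases n with _ | _ | n
  · rw [Finset.card_eq_zero] at hn
    subst hn
    refine ⟨0, ?_, by simp⟩
    rw [winding_eq_zero hF.continuousOn, Int.cast_zero, zero_mul]
    intro s hs t ht h0
    rw [uIcc_of_le (by assumption)] at hs ht
    exact absurd ((hZ (s, t)).2 ⟨hs, ht, h0⟩) (by simp)
  · obtain ⟨p, rfl⟩ := Finset.card_eq_one.1 hn
    have hp := (hZ p).1 (by simp)
    have h1 : a < p.1 := lt_of_le_of_ne hp.1.1 fun h ↦ (ht p.2 hp.2.1).1 (h ▸ hp.2.2)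
    have h2 : p.1 < b := lt_of_le_of_ne hp.1.2 fun h ↦ (ht p.2 hp.2.1).2 (h ▸ hp.2.2)
    have h3 : c < p.2 := lt_of_le_of_ne hp.2.1.1 fun h ↦ (hs p.1 hp.1).1 (h ▸ hp.2.2)
    have h4 : p.2 < d := lt_of_le_of_ne hp.2.1.2 fun h ↦ (hs p.1 hp.1).2 (h ▸ hp.2.2)
    obtain ⟨δ, hδ, hδ1, hδ2, hδ3, hδ4⟩ : ∃ δ > 0, a ≤ p.1 - δ ∧ p.1 + δ ≤ b ∧ c ≤ p.2 - δ ∧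
        p.2 + δ ≤ d := by
      refine ⟨min (min (p.1 - a) (b - p.1)) (min (p.2 - c) (d - p.2)), ?_, ?_, ?_, ?_, ?_⟩
      · simp [h1, h2, h3, h4]
      · linarith [min_le_left (min (p.1 - a) (b - p.1)) (min (p.2 - c) (d - p.2)),
          min_le_left (p.1 - a) (b - p.1)]
      · linarith [min_le_left (min (p.1 - a) (b - p.1)) (min (p.2 - c) (d - p.2)),
          min_le_right (p.1 - a) (b - p.1)]
      · linarith [min_le_right (min (p.1 - a) (b - p.1)) (min (p.2 - c) (d - p.2)),
          min_le_left (p.2 - c) (d - p.2)]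
      · linarith [min_le_right (min (p.1 - a) (b - p.1)) (min (p.2 - c) (d - p.2)),
          min_le_right (p.2 - c) (d - p.2)]
    obtain ⟨s₁, s₂, t₁, t₂, hs₁, hs₂, ht₁, ht₂, k, hk⟩ := hodd p (by simp) δ hδ
    refine ⟨2 * k + 1, ?_, ?_⟩
    · rw [winding_eq_of_unique_zero hF (p := p) (hδ1.trans hs₁.1.le) hs₁.2 hs₂.1
        (hs₂.2.le.trans hδ2) (hδ3.trans ht₁.1.le) ht₁.2 ht₂.1 (ht₂.2.le.trans hδ4) ?_ hs, hk]
      · push_cast; ring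
      · intro s hs t ht h0
        have := (hZ (s, t)).2 ⟨hs, ht, h0⟩
        simpa [Prod.ext_iff] using this
    · have : (2 : ZMod 2) = 0 := rfl
      simp [this]
  · obtain ⟨p, hp, q, hq, hpq⟩ := Finset.one_lt_card.1 (by omega : 1 < Z.card)
    wlog hlt : p.1 < q.1 generalizing p q
    · refine this q hq p hp hpq.symm (lt_of_le_of_ne (not_lt.1 hlt) fun h ↦ hpq ?_)
      exact hinj hp hq h.symm
    -- A vertical cut that avoids all zeros and separates p from q, so that both halves contain
    -- fewer zeros. Distinct first coordinates of the zeros guarantee that it exists.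
    obtain ⟨m, hm, hmZ⟩ := (Ioo_infinite hlt).exists_notMem_finset (Z.image Prod.fst)
    have hmne : ∀ z ∈ Z, z.1 ≠ m := fun z hz h ↦ hmZ (Finset.mem_image.2 ⟨z, hz, h⟩)
    have hp' := (hZ p).1 hp
    have hq' := (hZ q).1 hq
    have ham : a ≤ m := hp'.1.1.trans hm.1.le
    have hmb : m ≤ b := hm.2.le.trans hq'.1.2
    have hmt : ∀ t ∈ Icc c d, F m t ≠ 0 := fun t ht h0 ↦
      hmne (m, t) ((hZ (m, t)).2 ⟨⟨ham, hmb⟩, ht, h0⟩) rfl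
    have hcard := Finset.card_filter_add_card_filter_not (s := Z) (fun z ↦ z.1 < m)
    have hpos1 : 0 < (Z.filter fun z ↦ z.1 < m).card :=
      Finset.card_pos.2 ⟨p, Finset.mem_filter.2 ⟨hp, hm.1⟩⟩
    have hpos2 : 0 < (Z.filter fun z ↦ ¬ z.1 < m).card :=
      Finset.card_pos.2 ⟨q, Finset.mem_filter.2 ⟨hq, not_lt.2 hm.2.le⟩⟩
    obtain ⟨k₁, hk₁, hk₁'⟩ := ih _ (by omega) (Z.filter fun z ↦ z.1 < m) rfl ham
      (fun z ↦ by
        rw [Finset.mem_filter, hZ]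
        constructor
        · exact fun ⟨⟨h1, h2⟩, h3⟩ ↦ ⟨⟨h1.1, h3.le⟩, h2⟩
        · exact fun ⟨h1, h2, h3⟩ ↦ ⟨⟨⟨h1.1, h1.2.trans hmb⟩, h2, h3⟩,
            lt_of_le_of_ne h1.2 fun h ↦ hmt z.2 h2 (h ▸ h3)⟩)
      (fun s h ↦ hs s ⟨h.1, h.2.trans hmb⟩) (fun t h ↦ ⟨(ht t h).1, hmt t h⟩)
      (hinj.mono (Finset.coe_subset.2 (Finset.filter_subset _ _)))
      (fun z hz ↦ hodd z (Finset.mem_filter.1 hz).1)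
    obtain ⟨k₂, hk₂, hk₂'⟩ := ih _ (by omega) (Z.filter fun z ↦ ¬ z.1 < m) rfl hmb
      (fun z ↦ by
        rw [Finset.mem_filter, hZ]
        constructor
        · exact fun ⟨⟨h1, h2⟩, h3⟩ ↦ ⟨⟨not_lt.1 h3, h1.2⟩, h2⟩
        · exact fun ⟨h1, h2, h3⟩ ↦ ⟨⟨⟨ham.trans h1.1, h1.2⟩, h2, h3⟩, not_lt.2 h1.1⟩)
      (fun s h ↦ hs s ⟨ham.trans h.1, h.2⟩) (fun t h ↦ ⟨hmt t h, (ht t h).2⟩)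
      (hinj.mono (Finset.coe_subset.2 (Finset.filter_subset _ _)))
      (fun z hz ↦ hodd z (Finset.mem_filter.1 hz).1)
    refine ⟨k₁ + k₂, ?_, ?_⟩
    · rw [winding_add_left hF ham hmb (fun s h ↦ (hs s h).1) (fun s h ↦ (hs s h).2), hk₁, hk₂]
      push_cast; ring
    · push_cast
      rw [hk₁', hk₂', ← Nat.cast_add, hcard, hn]
      push_cast; rfl

/-! ### Transversal double points -/

/-- A continuous injective function on an interval is strictly monotone, and the intermediate value
theorem yields the values ±r. A negative r encodes a decreasing function. The symmetric range is
what `winding_axes` needs. -/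
lemma exists_symmetric_values {a : ℝ → ℝ} {s₀ δ ε : ℝ} (hδ : 0 < δ) (hε : 0 < ε)
    (ha : ContinuousOn a (Icc (s₀ - δ) (s₀ + δ))) (hi : InjOn a (Icc (s₀ - δ) (s₀ + δ)))
    (h0 : a s₀ = 0) :
    ∃ r s₁ s₂ : ℝ, r ≠ 0 ∧ |r| < ε ∧ s₁ ∈ Ioo (s₀ - δ) s₀ ∧ s₂ ∈ Ioo s₀ (s₀ + δ) ∧ a s₁ = -r ∧
      a s₂ = r ∧ MapsTo a (Icc s₁ s₂) (uIcc (-r) r) := by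
  have mono : ∀ f : ℝ → ℝ, ContinuousOn f (Icc (s₀ - δ) (s₀ + δ)) →
      StrictMonoOn f (Icc (s₀ - δ) (s₀ + δ)) → f s₀ = 0 →
      ∃ r s₁ s₂ : ℝ, 0 < r ∧ r < ε ∧ s₁ ∈ Ioo (s₀ - δ) s₀ ∧ s₂ ∈ Ioo s₀ (s₀ + δ) ∧ f s₁ = -r ∧
        f s₂ = r ∧ MapsTo f (Icc s₁ s₂) (Icc (-r) r) := by
    intro f hf hm hf0
    have hx : f (s₀ - δ) < 0 := by
      rw [← hf0]
      exact hm ⟨le_rfl, by linarith⟩ ⟨by linarith, by linarith⟩ (by linarith)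
    have hy : 0 < f (s₀ + δ) := by
      rw [← hf0]
      exact hm ⟨by linarith, by linarith⟩ ⟨by linarith, le_rfl⟩ (by linarith)
    obtain ⟨r, hr, hr'⟩ := exists_between (show 0 < min (min (-f (s₀ - δ)) (f (s₀ + δ))) ε by
      simp [hx, hy, hε])
    simp only [lt_min_iff] at hr'
    obtain ⟨s₁, hs₁, h1⟩ := intermediate_value_Ioo (by linarith : s₀ - δ ≤ s₀)
      (hf.mono (Icc_subset_Icc_right (by linarith))) (show -r ∈ Ioo (f (s₀ - δ)) (f s₀) from
        ⟨by linarith, by linarith⟩)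
    obtain ⟨s₂, hs₂, h2⟩ := intermediate_value_Ioo (by linarith : s₀ ≤ s₀ + δ)
      (hf.mono (Icc_subset_Icc_left (by linarith))) (show r ∈ Ioo (f s₀) (f (s₀ + δ)) from
        ⟨by linarith, by linarith⟩)
    refine ⟨r, s₁, s₂, hr, hr'.2, hs₁, hs₂, h1, h2, fun s hs ↦ ?_⟩
    rw [← h1, ← h2]
    exact ⟨hm.monotoneOn ⟨hs₁.1.le, by linarith [hs₁.2]⟩
      ⟨by linarith [hs₁.1, hs.1], by linarith [hs₂.2, hs.2]⟩ hs.1,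
      hm.monotoneOn ⟨by linarith [hs₁.1, hs.1], by linarith [hs₂.2, hs.2]⟩
      ⟨by linarith [hs₂.1], hs₂.2.le⟩ hs.2⟩
  rcases ha.strictMonoOn_of_injOn_Icc' (by linarith) hi with hm | hm
  · obtain ⟨r, s₁, s₂, hr, hrε, hs₁, hs₂, h1, h2, hmaps⟩ := mono a ha hm h0
    exact ⟨r, s₁, s₂, hr.ne', by rwa [abs_of_pos hr], hs₁, hs₂, h1, h2,
      by rwa [uIcc_of_le (by linarith)]⟩
  · obtain ⟨r, s₁, s₂, hr, hrε, hs₁, hs₂, h1, h2, hmaps⟩ := mono (fun s ↦ -a s) ha.neg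
      (fun x hx y hy hxy ↦ neg_lt_neg (hm hx hy hxy)) (by simp [h0])
    refine ⟨-r, s₁, s₂, by simp [hr.ne'], by rwa [abs_neg, abs_of_pos hr], hs₁, hs₂,
      by linarith, by linarith, fun s hs ↦ ?_⟩
    have := hmaps hs
    rw [neg_neg, uIcc_of_ge (by linarith)]
    exact ⟨by linarith [this.2], by linarith [this.1]⟩

/-- The identification of the plane with the complex numbers. -/
noncomputable def planeToComplex : Plane ≃ₗᵢ[ℝ] ℂ := Complex.orthonormalBasisOneI.repr.symm

/-- A transversal crossing of two locally injective plane curves has odd index. -/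
lemma hasOddIndex_of_transversal {α β : ℝ → Plane} (hα : Continuous α) (hβ : Continuous β)
    {s₀ t₀ : ℝ} (h₀ : α s₀ = β t₀) (hαi : ∃ U ∈ 𝓝 s₀, InjOn α U) (hβi : ∃ U ∈ 𝓝 t₀, InjOn β U)
    (h : OpenPartialHomeomorph Plane Plane) (hs : α s₀ ∈ h.source) (hz : h (α s₀) = 0)
    (hα0 : ∀ᶠ s in 𝓝 s₀, h (α s) 1 = 0) (hβ0 : ∀ᶠ t in 𝓝 t₀, h (β t) 0 = 0) :
    HasOddIndex (fun s t ↦ planeToComplex (α s) - planeToComplex (β t)) (s₀, t₀) := by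
  intro δ hδ
  obtain ⟨U, hU, hUi⟩ := hαi
  obtain ⟨U', hU', hUi'⟩ := hβi
  have hsrc : h.source ∈ 𝓝 (α s₀) := h.open_source.mem_nhds hs
  let e : ℝ × ℝ → Plane := fun p ↦ !₂[p.1, p.2]
  have he : Continuous e := by
    refine (PiLp.continuous_toLp 2 _).comp (continuous_pi fun i ↦ ?_)
    fin_cases i
    · exact continuous_fst
    · exact continuous_snd
  have he0 : e 0 = 0 := by ext i; fin_cases i <;> rfl
  have hei : Function.Injective e := fun p q hpq ↦ by
    have h0 := congrArg (fun x : Plane ↦ x 0) hpq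
    have h1 := congrArg (fun x : Plane ↦ x 1) hpq
    exact Prod.ext h0 h1
  obtain ⟨ε, hε, hball⟩ := Metric.mem_nhds_iff.1 (he.continuousAt.preimage_mem_nhds
    (t := h.target) (x := 0) (by
      rw [he0, ← hz]; exact h.open_target.mem_nhds (h.map_source hs)))
  -- The inverse chart, in which the branches α and β become the restrictions of g to the two axes.
  let g : ℝ × ℝ → ℂ := fun p ↦ planeToComplex (h.symm (e p))
  have hgc : ContinuousOn g (Metric.ball 0 ε) :=
    planeToComplex.continuous.comp_continuousOn
      (h.continuousOn_symm.comp he.continuousOn hball)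
  have hgi : InjOn g (Metric.ball 0 ε) := fun p hp q hq hpq ↦
    hei (h.symm.injOn (hball hp) (hball hq) (planeToComplex.injective hpq))
  have key : ∀ (γ : ℝ → Plane) (x : ℝ) (i j : Fin 2) (W : Set ℝ), i ≠ j → Continuous γ →
      γ x = α s₀ → W ∈ 𝓝 x → InjOn γ W → (∀ᶠ s in 𝓝 x, h (γ s) j = 0) →
      ∃ r x₁ x₂ : ℝ, r ≠ 0 ∧ |r| < ε ∧ x₁ ∈ Ioo (x - δ) x ∧ x₂ ∈ Ioo x (x + δ) ∧
        h (γ x₁) i = -r ∧ h (γ x₂) i = r ∧ MapsTo (fun s ↦ h (γ s) i) (Icc x₁ x₂) (uIcc (-r) r) ∧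
        (∀ s ∈ Icc x₁ x₂, γ s ∈ h.source ∧ h (γ s) j = 0) ∧
        ContinuousOn (fun s ↦ h (γ s) i) (Icc x₁ x₂) := by
    intro γ x i j W hij hγ hγx hW hWi hγ0
    have hev : ∀ᶠ s in 𝓝 x, s ∈ W ∧ γ s ∈ h.source ∧ h (γ s) j = 0 :=
      (Filter.eventually_mem_set.2 hW).and
        ((hγ.continuousAt.eventually_mem (by rwa [hγx])).and hγ0)
    obtain ⟨η, hη, hηb⟩ := Metric.eventually_nhds_iff.1 hev
    obtain ⟨ρ, hρ, hρ'⟩ := exists_between (lt_min hδ hη)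
    simp only [lt_min_iff] at hρ'
    have hin : ∀ s ∈ Icc (x - ρ) (x + ρ), s ∈ W ∧ γ s ∈ h.source ∧ h (γ s) j = 0 :=
      fun s hs ↦ hηb (by
        rw [Real.dist_eq, abs_lt]
        constructor <;> linarith [hs.1, hs.2])
    have hac : ContinuousOn (fun s ↦ h (γ s) i) (Icc (x - ρ) (x + ρ)) :=
      (PiLp.continuous_apply 2 (fun _ : Fin 2 ↦ ℝ) i).comp_continuousOn
        (h.continuousOn.comp hγ.continuousOn fun s hs ↦ (hin s hs).2.1)
    -- The other coordinate vanishes along the branch, so local injectivity of γ passes to this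
    -- coordinate alone.
    have hai : InjOn (fun s ↦ h (γ s) i) (Icc (x - ρ) (x + ρ)) := fun s hs t ht hst ↦ by
      refine hWi (hin s hs).1 (hin t ht).1 (h.injOn (hin s hs).2.1 (hin t ht).2.1 ?_)
      ext k
      have : k = i ∨ k = j := by omega
      rcases this with rfl | rfl
      · exact hst
      · rw [(hin s hs).2.2, (hin t ht).2.2]
    obtain ⟨r, x₁, x₂, hr, hrε, hx₁, hx₂, h1, h2, hm⟩ := exists_symmetric_values hρ hε hac hai
      (by simp [hγx, hz])
    have hsub : Icc x₁ x₂ ⊆ Icc (x - ρ) (x + ρ) := Icc_subset_Icc hx₁.1.le hx₂.2.le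
    exact ⟨r, x₁, x₂, hr, hrε, ⟨by linarith [hx₁.1], hx₁.2⟩, ⟨hx₂.1, by linarith [hx₂.2]⟩, h1, h2,
      hm, fun s hs ↦ (hin s (hsub hs)).2, hac.mono hsub⟩
  obtain ⟨r, s₁, s₂, hr, hrε, hs₁, hs₂, hr1, hr2, hrm, hrs, hrc⟩ :=
    key α s₀ 0 1 U (by decide) hα rfl hU hUi hα0
  obtain ⟨q, t₁, t₂, hq, hqε, ht₁, ht₂, hq1, hq2, hqm, hqs, hqc⟩ :=
    key β t₀ 1 0 U' (by decide) hβ h₀.symm hU' hUi' hβ0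
  refine ⟨s₁, s₂, t₁, t₂, hs₁, hs₂, ht₁, ht₂, ?_⟩
  obtain ⟨k, hk⟩ := winding_axes hgc hgi hrε hqε hr hq
  refine ⟨k, ?_⟩
  rw [← hk]
  have hs12 : s₁ ≤ s₂ := hs₁.2.le.trans hs₂.1.le
  have ht12 : t₁ ≤ t₂ := ht₁.2.le.trans ht₂.1.le
  have hbs : ∀ u ∈ uIcc (-r) r, ((u, 0) : ℝ × ℝ) ∈ Metric.ball 0 ε := fun u hu ↦ by
    simp [Prod.norm_def, abs_lt_of_mem_uIcc_neg hrε hu]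
  have hbt : ∀ v ∈ uIcc (-q) q, ((0, v) : ℝ × ℝ) ∈ Metric.ball 0 ε := fun v hv ↦ by
    simp [Prod.norm_def, abs_lt_of_mem_uIcc_neg hqε hv]
  have hcomp := winding_comp (G := fun u v ↦ g (u, 0) - g (0, v)) (φ := fun s ↦ h (α s) 0)
    (ψ := fun t ↦ h (β t) 1) (a := s₁) (b := s₂) (c := t₁) (d := t₂)
    (by rwa [uIcc_of_le hs12]) (by rw [uIcc_of_le hs12]; simpa only [hr1, hr2] using hrm)
    (by rwa [uIcc_of_le ht12]) (by rw [uIcc_of_le ht12]; simpa only [hq1, hq2] using hqm)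
    (by
      simp only [hr1, hr2, hq1, hq2]
      exact (hgc.comp (f := fun p : ℝ × ℝ ↦ (p.1, 0)) (by fun_prop) fun p hp ↦ hbs _ hp.1).sub
        (hgc.comp (f := fun p : ℝ × ℝ ↦ (0, p.2)) (by fun_prop) fun p hp ↦ hbt _ hp.2))
    (by
      simp only [hr1, hr2, hq1, hq2]
      intro u hu v hv hb h0
      have := hgi (hbs u hu) (hbt v hv) (sub_eq_zero.1 h0)
      simp only [Prod.mk.injEq] at this
      obtain ⟨rfl, rfl⟩ := this
      rcases hb with h | h | h | h
      · exact hr (by linarith)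
      · exact hr h.symm
      · exact hq (by linarith)
      · exact hq h.symm)
  simp only [hr1, hr2, hq1, hq2] at hcomp
  rw [← hcomp]
  refine winding_congr fun s hs t ht ↦ ?_
  rw [uIcc_of_le (by assumption)] at hs ht
  have e1 : e (h (α s) 0, 0) = h (α s) := by
    ext i; fin_cases i
    · rfl
    · exact (hrs s hs).2.symm
  have e2 : e (0, h (β t) 1) = h (β t) := by
    ext i; fin_cases i
    · exact (hqs t ht).2.symm
    · rfl
  simp only [g]
  rw [e1, e2, h.left_inv (hrs s hs).1, h.left_inv (hqs t ht).1]

/-! ### Edges of the geometric realization -/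

section Edges

variable {V : Type*} [DecidableEq V]

lemma closedEdge_mk (a b : V) : closedEdge s(a, b) = segment ℝ (vertexPoint a) (vertexPoint b) := by
  rw [closedEdge, ← convexHull_pair, ← image_pair]
  congr 2
  ext v
  simp

lemma vertexPoint_mem_realization (G : SimpleGraph V) (v : V) : vertexPoint v ∈ realization G :=
  .inl ⟨v, rfl⟩

/-- The vertex `v` as a point of the realization. -/
def vertexMap (G : SimpleGraph V) (v : V) : realization G :=
  ⟨vertexPoint v, vertexPoint_mem_realization G v⟩

lemma lineMap_mem_realization {G : SimpleGraph V} {a b : V} (h : G.Adj a b) (t : ℝ) :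
    AffineMap.lineMap (vertexPoint a) (vertexPoint b) (clamp 0 1 t) ∈ realization G := by
  refine .inr (mem_iUnion₂.2 ⟨s(a, b), h, ?_⟩)
  rw [closedEdge_mk, segment_eq_image_lineMap]
  refine mem_image_of_mem _ ?_
  simpa using clamp_mem 0 1 t

/-- The parametrization of the edge from `a` to `b` by the unit interval, extended to be constant
on both sides of the interval. -/
noncomputable def edgePath {G : SimpleGraph V} {a b : V} (h : G.Adj a b) (t : ℝ) : realization G :=
  ⟨AffineMap.lineMap (vertexPoint a) (vertexPoint b) (clamp 0 1 t), lineMap_mem_realization h t⟩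

variable {G : SimpleGraph V} {a b c d : V}

lemma continuous_edgePath (h : G.Adj a b) : Continuous (edgePath h) :=
  Continuous.subtype_mk (AffineMap.lineMap_continuous.comp (continuous_clamp 0 1)) _

lemma edgePath_coe (h : G.Adj a b) {t : ℝ} (ht : t ∈ Icc (0 : ℝ) 1) :
    (edgePath h t : V → ℝ) = AffineMap.lineMap (vertexPoint a) (vertexPoint b) t := by
  simp only [edgePath, clamp_of_mem (by rwa [uIcc_of_le zero_le_one] : t ∈ uIcc (0 : ℝ) 1)]

lemma edgePath_apply (h : G.Adj a b) {t : ℝ} (ht : t ∈ Icc (0 : ℝ) 1) (v : V) :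
    (edgePath h t : V → ℝ) v = (if v = a then 1 - t else 0) + (if v = b then t else 0) := by
  rw [edgePath_coe h ht, AffineMap.lineMap_apply_module]
  simp [vertexPoint, Pi.single_apply]

lemma edgePath_zero (h : G.Adj a b) : edgePath h 0 = vertexMap G a :=
  Subtype.ext (by rw [edgePath_coe h (by simp)]; simp [vertexMap])

lemma edgePath_one (h : G.Adj a b) : edgePath h 1 = vertexMap G b :=
  Subtype.ext (by rw [edgePath_coe h (by simp)]; simp [vertexMap])

lemma injOn_edgePath (h : G.Adj a b) : InjOn (edgePath h) (Icc 0 1) := fun s hs t ht hst ↦ by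
  have := congrArg (fun x : realization G ↦ (x : V → ℝ) b) hst
  simpa [edgePath_apply h hs, edgePath_apply h ht, h.ne'] using this

lemma image_edgePath (h : G.Adj a b) :
    edgePath h '' Icc 0 1 = {x : realization G | (x : V → ℝ) ∈ closedEdge s(a, b)} := by
  ext x
  rw [mem_ofPred_eq, closedEdge_mk, segment_eq_image_lineMap]
  constructor
  · rintro ⟨t, ht, rfl⟩
    exact ⟨t, ht, (edgePath_coe h ht).symm⟩
  · rintro ⟨t, ht, hx⟩
    exact ⟨t, ht, Subtype.ext ((edgePath_coe h ht).trans hx)⟩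

lemma edgeImage_mk (f : realization G → Plane) (h : G.Adj a b) :
    edgeImage f s(a, b) = (fun t ↦ f (edgePath h t)) '' Icc 0 1 := by
  rw [edgeImage, ← image_edgePath h, image_image]

lemma vertexMap_injective : Function.Injective (vertexMap G) := fun v w h ↦ by
  have := congrArg (fun x : realization G ↦ (x : V → ℝ) v) h
  by_contra hne
  simp [vertexMap, vertexPoint, hne] at this

lemma edgePath_ne_vertexMap (h : G.Adj a b) {v : V} (ha : v ≠ a) (hb : v ≠ b) {t : ℝ}
    (ht : t ∈ Icc (0 : ℝ) 1) : edgePath h t ≠ vertexMap G v := fun heq ↦ by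
  have := congrArg (fun x : realization G ↦ (x : V → ℝ) v) heq
  simp [edgePath_apply h ht, vertexMap, vertexPoint, ha, hb] at this

/-- At a common point the coordinates 1 - s at a and s at b would both vanish. -/
lemma edgePath_ne_edgePath (h : G.Adj a b) (h' : G.Adj c d) (hac : a ≠ c) (had : a ≠ d)
    (hbc : b ≠ c) (hbd : b ≠ d) {s t : ℝ} (hs : s ∈ Icc (0 : ℝ) 1) (ht : t ∈ Icc (0 : ℝ) 1) :
    edgePath h s ≠ edgePath h' t := fun heq ↦ by
  have h1 := congrArg (fun x : realization G ↦ (x : V → ℝ) a) heq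
  have h2 := congrArg (fun x : realization G ↦ (x : V → ℝ) b) heq
  simp [edgePath_apply h hs, edgePath_apply h' ht, h.ne, h.ne', hac, had, hbc, hbd] at h1 h2
  linarith

end Edges

/-! ### Crossings of two disjoint edges -/

namespace IsPlaneGenericImmersion

variable {V : Type*} [DecidableEq V] {G : SimpleGraph V} {f : realization G → Plane}
  {a b c d : V}

lemma mem_Ioo_of_edgePath (hf : IsPlaneGenericImmersion f) (h : G.Adj a b) {t : ℝ}
    (ht : t ∈ Icc (0 : ℝ) 1) {y : realization G} (hne : edgePath h t ≠ y)
    (heq : f (edgePath h t) = f y) : t ∈ Ioo (0 : ℝ) 1 := by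
  refine ⟨lt_of_le_of_ne ht.1 ?_, lt_of_le_of_ne ht.2 ?_⟩
  · rintro rfl
    exact hf.ne_vertex _ _ hne heq a (by rw [edgePath_zero, vertexMap])
  · rintro rfl
    exact hf.ne_vertex _ _ hne heq b (by rw [edgePath_one, vertexMap])

lemma apply_edgePath_ne_apply_vertexMap (hf : IsPlaneGenericImmersion f) (h : G.Adj a b) {v : V}
    (ha : v ≠ a) (hb : v ≠ b) {t : ℝ} (ht : t ∈ Icc (0 : ℝ) 1) :
    f (edgePath h t) ≠ f (vertexMap G v) := fun heq ↦
  hf.ne_vertex _ _ (edgePath_ne_vertexMap h ha hb ht).symm heq.symm v rfl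

lemma apply_vertexMap_ne (hf : IsPlaneGenericImmersion f) {v w : V} (h : v ≠ w) :
    f (vertexMap G v) ≠ f (vertexMap G w) := fun heq ↦
  hf.ne_vertex _ _ (vertexMap_injective.ne h) heq v rfl

lemma exists_injOn_edgePath (hf : IsPlaneGenericImmersion f) (h : G.Adj a b) {t : ℝ}
    (ht : t ∈ Ioo (0 : ℝ) 1) : ∃ U ∈ 𝓝 t, InjOn (fun s ↦ f (edgePath h s)) U := by
  obtain ⟨U, hUo, hU, hUi⟩ := hf.locally_injective (edgePath h t)
  refine ⟨edgePath h ⁻¹' U ∩ Icc 0 1, Filter.inter_mem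
    ((continuous_edgePath h).continuousAt.preimage_mem_nhds (hUo.mem_nhds hU))
    (Icc_mem_nhds ht.1 ht.2), ?_⟩
  exact fun x hx y hy hxy ↦ injOn_edgePath h hx.2 hy.2 (hUi hx.1 hy.1 hxy)

/-- The number of crossings of two disjoint edges is congruent modulo two to the winding number of
the difference of the two edges. -/
lemma winding_eq_ncard (hf : IsPlaneGenericImmersion f) (h : G.Adj a b) (h' : G.Adj c d)
    (hac : a ≠ c) (had : a ≠ d) (hbc : b ≠ c) (hbd : b ≠ d) :
    ∃ k : ℤ, winding (fun s t ↦ planeToComplex (f (edgePath h s)) -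
        planeToComplex (f (edgePath h' t))) 0 1 0 1 = k * (2 * Real.pi * I) ∧
      (k : ZMod 2) = (edgeImage f s(a, b) ∩ edgeImage f s(c, d)).ncard := by
  have hα : Continuous fun s ↦ f (edgePath h s) := hf.continuous.comp (continuous_edgePath h)
  have hβ : Continuous fun s ↦ f (edgePath h' s) := hf.continuous.comp (continuous_edgePath h')
  set F : ℝ → ℝ → ℂ := fun s t ↦ planeToComplex (f (edgePath h s)) -
        planeToComplex (f (edgePath h' t)) with hFdef
  have hF : Continuous (Function.uncurry F) :=
    (planeToComplex.continuous.comp (hα.comp continuous_fst)).sub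
      (planeToComplex.continuous.comp (hβ.comp continuous_snd))
  have hF0 : ∀ s t, F s t = 0 ↔ f (edgePath h s) = f (edgePath h' t) := fun s t ↦ by
    rw [hFdef]
    simp only [sub_eq_zero, planeToComplex.injective.eq_iff]
  have hne : ∀ s ∈ Icc (0 : ℝ) 1, ∀ t ∈ Icc (0 : ℝ) 1, edgePath h s ≠ edgePath h' t :=
    fun s hs t ht ↦ edgePath_ne_edgePath h h' hac had hbc hbd hs ht
  -- Since there are no triple points, a crossing point determines both parameters. Zeros of F thus
  -- correspond bijectively to crossing points, and different zeros have different first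
  -- coordinates.
  have hcross : ∀ s s' t t', s ∈ Icc (0 : ℝ) 1 → s' ∈ Icc (0 : ℝ) 1 → t ∈ Icc (0 : ℝ) 1 →
      t' ∈ Icc (0 : ℝ) 1 → f (edgePath h s) = f (edgePath h' t) →
      f (edgePath h s') = f (edgePath h' t') → f (edgePath h s) = f (edgePath h s') →
      s = s' ∧ t = t' := by
    intro s s' t t' hs hs' ht ht' e e' e''
    constructor
    · rcases hf.double _ _ _ e'' (e''.symm.trans e) with h1 | h1 | h1
      · exact injOn_edgePath h hs hs' h1
      · exact absurd h1 (hne _ hs' _ ht)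
      · exact absurd h1 (hne _ hs _ ht)
    · rcases hf.double _ _ _ e (e.symm.trans (e''.trans e')) with h1 | h1 | h1
      · exact absurd h1 (hne _ hs _ ht)
      · exact injOn_edgePath h' ht ht' h1
      · exact absurd h1 (hne _ hs _ ht')
  let S : Set (ℝ × ℝ) := {p | p.1 ∈ Icc (0 : ℝ) 1 ∧ p.2 ∈ Icc (0 : ℝ) 1 ∧ F p.1 p.2 = 0}
  have himg : (fun p : ℝ × ℝ ↦ f (edgePath h p.1)) '' S
      = edgeImage f s(a, b) ∩ edgeImage f s(c, d) := by
    rw [edgeImage_mk f h, edgeImage_mk f h']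
    ext x
    constructor
    · rintro ⟨p, ⟨hp1, hp2, hp⟩, rfl⟩
      exact ⟨⟨p.1, hp1, rfl⟩, ⟨p.2, hp2, ((hF0 _ _).1 hp).symm⟩⟩
    · rintro ⟨⟨s, hs, rfl⟩, ⟨t, ht, hst⟩⟩
      exact ⟨(s, t), ⟨hs, ht, (hF0 _ _).2 hst.symm⟩, rfl⟩
  have hinj : InjOn (fun p : ℝ × ℝ ↦ f (edgePath h p.1)) S := fun p hp q hq hpq ↦ by
    have := hcross p.1 q.1 p.2 q.2 hp.1 hq.1 hp.2.1 hq.2.1 ((hF0 _ _).1 hp.2.2)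
      ((hF0 _ _).1 hq.2.2) hpq
    exact Prod.ext this.1 this.2
  have hfin : S.Finite := by
    refine Finite.of_finite_image (hf.finite_multiple.subset ?_) hinj
    rintro _ ⟨p, hp, rfl⟩
    exact ⟨edgePath h p.1, edgePath h' p.2, hne _ hp.1 _ hp.2.1, rfl, ((hF0 _ _).1 hp.2.2).symm⟩
  have hin : ∀ s ∈ Icc (0 : ℝ) 1, ∀ t ∈ Icc (0 : ℝ) 1, F s t = 0 →
      s ∈ Ioo (0 : ℝ) 1 ∧ t ∈ Ioo (0 : ℝ) 1 := fun s hs t ht h0 ↦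
    ⟨hf.mem_Ioo_of_edgePath h hs (hne s hs t ht) ((hF0 _ _).1 h0),
      hf.mem_Ioo_of_edgePath h' ht (hne s hs t ht).symm ((hF0 _ _).1 h0).symm⟩
  obtain ⟨k, hk, hk'⟩ := winding_eq_card_zeros hF zero_le_one _ hfin.toFinset rfl zero_le_one
    (fun p ↦ by rw [hfin.mem_toFinset]; rfl)
    (fun s hs ↦ ⟨fun h0 ↦ lt_irrefl _ (hin s hs 0 (by simp) h0).2.1,
      fun h0 ↦ lt_irrefl _ (hin s hs 1 (by simp) h0).2.2⟩)
    (fun t ht ↦ ⟨fun h0 ↦ lt_irrefl _ (hin 0 (by simp) t ht h0).1.1,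
      fun h0 ↦ lt_irrefl _ (hin 1 (by simp) t ht h0).1.2⟩)
    (fun p hp q hq hpq ↦ hinj (hfin.mem_toFinset.1 hp) (hfin.mem_toFinset.1 hq) (by simp [hpq]))
    (fun p hp ↦ by
      obtain ⟨hp1, hp2, hp0⟩ := hfin.mem_toFinset.1 hp
      have heq := (hF0 _ _).1 hp0
      obtain ⟨φ, hφ, hφ0, hφ1, hφ2⟩ := hf.transversal _ _ (hne _ hp1 _ hp2) heq
      exact hasOddIndex_of_transversal hα hβ heq
        (hf.exists_injOn_edgePath h (hin _ hp1 _ hp2 hp0).1)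
        (hf.exists_injOn_edgePath h' (hin _ hp1 _ hp2 hp0).2) φ hφ hφ0
        ((continuous_edgePath h).continuousAt.eventually hφ1)
        ((continuous_edgePath h').continuousAt.eventually hφ2))
  refine ⟨k, hk, ?_⟩
  rw [hk', ← himg, hinj.ncard_image, ncard_eq_toFinset_card S hfin]

/-- Logarithms of the differences of the images of the vertices. -/
lemma exists_log_sub (hf : IsPlaneGenericImmersion f) (r : V → ℕ) (hr : Function.Injective r) :
    ∃ θ : V → V → ℂ, ∀ x y, x ≠ y →
      exp (θ x y) = planeToComplex (f (vertexMap G x)) - planeToComplex (f (vertexMap G y)) ∧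
      θ y x - θ x y = (1 - 2 * ((if r y < r x then 1 else 0 : ℕ) : ℂ)) * (Real.pi * I) := by
  let z : V → ℂ := fun x ↦ planeToComplex (f (vertexMap G x))
  have hz : ∀ x y, x ≠ y → z x - z y ≠ 0 := fun x y hxy ↦
    sub_ne_zero.2 (planeToComplex.injective.ne (hf.apply_vertexMap_ne hxy))
  -- The principal logarithm serves for pairs of increasing rank, and the reversed pair gets the
  -- same value plus πi.
  refine ⟨fun x y ↦ if r x < r y then log (z x - z y) else log (z y - z x) + Real.pi * I,
    fun x y hxy ↦ ?_⟩
  rcases lt_or_gt_of_ne (hr.ne hxy) with hlt | hlt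
  · simp only [hlt, if_true, hlt.not_gt, if_false]
    refine ⟨exp_log (hz x y hxy), by push_cast; ring⟩
  · simp only [hlt, if_true, hlt.not_gt, if_false]
    refine ⟨?_, by push_cast; ring⟩
    rw [exp_add, exp_log (hz y x hxy.symm), exp_pi_mul_I]
    ring

/-- Parity of the number of crossings of two disjoint edges, up to a term that depends on pairs of
an edge and a vertex only. -/
lemma exists_crossing_parity (hf : IsPlaneGenericImmersion f) (r : V → ℕ)
    (hr : Function.Injective r) :
    ∃ n : V → V → V → ZMod 2, ∀ a b c d, G.Adj a b → G.Adj c d → a ≠ c → a ≠ d → b ≠ c → b ≠ d →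
      ((edgeImage f s(a, b) ∩ edgeImage f s(c, d)).ncard : ZMod 2) =
        (n a b c + n a b d) + (n c d a + n c d b) +
        (((if r b < r c then 1 else 0) + (if r d < r b then 1 else 0) +
          (if r a < r d then 1 else 0) + (if r c < r a then 1 else 0) : ℕ) : ZMod 2) := by
  obtain ⟨θ, hθ⟩ := hf.exists_log_sub r hr
  -- The integer m measures how the edge winds past the vertex, relative to θ. It serves both signs
  -- of the difference, hence sides of either direction of the square.
  have hex : ∀ a b v, ∃ m : ℤ, ∀ h : G.Adj a b, v ≠ a → v ≠ b →
      logChange (fun s ↦ planeToComplex (f (edgePath h s)) -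
        planeToComplex (f (vertexMap G v))) 0 1 = θ b v - θ a v + m * (2 * Real.pi * I) ∧
      logChange (fun s ↦ planeToComplex (f (vertexMap G v)) -
        planeToComplex (f (edgePath h s))) 0 1 = θ b v - θ a v + m * (2 * Real.pi * I) := by
    intro a b v
    by_cases hall : G.Adj a b ∧ v ≠ a ∧ v ≠ b
    swap
    · exact ⟨0, fun h h1 h2 ↦ absurd ⟨h, h1, h2⟩ hall⟩
    obtain ⟨h, ha, hb⟩ := hall
    have hc : ContinuousOn (fun s ↦ planeToComplex (f (edgePath h s)) -
        planeToComplex (f (vertexMap G v))) (uIcc 0 1) :=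
      ((planeToComplex.continuous.comp (hf.continuous.comp (continuous_edgePath h))).sub
        continuous_const).continuousOn
    have h0 : ∀ s ∈ uIcc (0 : ℝ) 1, planeToComplex (f (edgePath h s)) -
        planeToComplex (f (vertexMap G v)) ≠ 0 := fun s hs ↦ by
      rw [uIcc_of_le zero_le_one] at hs
      exact sub_ne_zero.2 (planeToComplex.injective.ne
        (hf.apply_edgePath_ne_apply_vertexMap h ha hb hs))
    obtain ⟨m, hm⟩ := exp_eq_exp_iff_exists_int.1 (show
      exp (logChange (fun s ↦ planeToComplex (f (edgePath h s)) -
        planeToComplex (f (vertexMap G v))) 0 1) = exp (θ b v - θ a v) by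
      rw [exp_logChange hc h0, exp_sub, (hθ b v hb.symm).1, (hθ a v ha.symm).1, edgePath_one,
        edgePath_zero])
    refine ⟨m, fun _ _ _ ↦ ⟨hm, ?_⟩⟩
    rw [← hm, ← logChange_neg hc h0]
    simp only [neg_sub]
  choose m hm using hex
  refine ⟨fun a b v ↦ m a b v, fun a b c d h h' hac had hbc hbd ↦ ?_⟩
  obtain ⟨k, hk, hk'⟩ := hf.winding_eq_ncard h h' hac had hbc hbd
  rw [← hk']
  simp only [winding, edgePath_zero, edgePath_one] at hk
  rw [(hm a b c h hac.symm hbc.symm).1, (hm a b d h had.symm hbd.symm).1,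
    (hm c d a h' hac had).2, (hm c d b h' hbc hbd).2] at hk
  have e1 := (hθ c b hbc.symm).2
  have e2 := (hθ b d hbd).2
  have e3 := (hθ d a had.symm).2
  have e4 := (hθ a c hac).2
  -- At each corner the adjacent sides contribute θ x y and -θ y x. The four defects ±πi add up to
  -- 2πi times 2 minus the number of descents of rank in the cyclic sequence a, c, b, d.
  have hk2 : (k : ℂ) = ((m a b c - m a b d - m c d a + m c d b + 2 -
      ((if r b < r c then 1 else 0) + (if r d < r b then 1 else 0) +
          (if r a < r d then 1 else 0) + (if r c < r a then 1 else 0) : ℕ) : ℤ) : ℂ) := by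
    refine mul_right_cancel₀ two_pi_I_ne_zero ?_
    rw [← hk]
    push_cast at e1 e2 e3 e4 ⊢
    linear_combination e1 + e2 + e3 + e4
  have hk3 : k = _ := Int.cast_injective hk2
  rw [hk3]
  have h2 : (2 : ZMod 2) = 0 := rfl
  push_cast
  simp only [CharTwo.sub_eq_add, h2]
  ring

end IsPlaneGenericImmersion

/-! ### The Petersen graph -/

lemma edgeDist_eq_one_iff {V : Type*} (G : SimpleGraph V) (d e : Sym2 V) :
    edgeDist G d e = 1 ↔ (∀ u ∈ d, ∀ v ∈ e, u ≠ v) ∧ ∃ u ∈ d, ∃ v ∈ e, G.Adj u v := by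
  have hle : (1 : ℕ∞) ≤ edgeDist G d e ↔ ∀ u ∈ d, ∀ v ∈ e, u ≠ v := by
    simp only [edgeDist, le_iInf_iff]
    refine forall₄_congr fun u _ v _ ↦ ?_
    rw [Order.one_le_iff_pos, pos_iff_ne_zero, Ne, SimpleGraph.edist_eq_zero_iff]
  constructor
  · intro h
    refine ⟨hle.1 h.ge, ?_⟩
    have hlt : edgeDist G d e < 2 := by rw [h]; exact_mod_cast Nat.one_lt_two
    simp only [edgeDist, iInf_lt_iff] at hlt
    obtain ⟨u, hu, v, hv, huv⟩ := hlt
    refine ⟨u, hu, v, hv, SimpleGraph.edist_eq_one_iff_adj.1 (le_antisymm ?_ ?_)⟩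
    · obtain ⟨n, hn⟩ := ENat.ne_top_iff_exists.1 huv.ne_top
      rw [← hn] at huv ⊢
      have : n < 2 := by exact_mod_cast huv
      exact_mod_cast Nat.le_of_lt_succ this
    · rw [← h]
      exact (iInf₂_le u hu).trans (iInf₂_le v hv)
  · rintro ⟨h, u, hu, v, hv, huv⟩
    refine le_antisymm ?_ (hle.2 h)
    rw [← SimpleGraph.edist_eq_one_iff_adj.2 huv]
    exact (iInf₂_le u hu).trans (iInf₂_le v hv)

instance : DecidableRel petersen.Adj
  | .inl i, .inl j => inferInstanceAs (Decidable (Sum.inl i ≠ Sum.inl j ∧ (j = i + 1 ∨ i = j + 1)))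
  | .inl i, .inr j => inferInstanceAs (Decidable (Sum.inl i ≠ Sum.inr j ∧ (j = i ∨ False)))
  | .inr i, .inl j => inferInstanceAs (Decidable (Sum.inr i ≠ Sum.inl j ∧ (False ∨ i = j)))
  | .inr i, .inr j => inferInstanceAs (Decidable (Sum.inr i ≠ Sum.inr j ∧ (j = i + 2 ∨ i = j + 2)))

/-- The edges of the Petersen graph, with an orientation. -/
def petersenEnds : Fin 15 → (ZMod 5 ⊕ ZMod 5) × (ZMod 5 ⊕ ZMod 5) :=
  ![(.inl 0, .inl 1), (.inl 1, .inl 2), (.inl 2, .inl 3), (.inl 3, .inl 4), (.inl 4, .inl 0),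
    (.inl 0, .inr 0), (.inl 1, .inr 1), (.inl 2, .inr 2), (.inl 3, .inr 3), (.inl 4, .inr 4),
    (.inr 0, .inr 2), (.inr 1, .inr 3), (.inr 2, .inr 4), (.inr 3, .inr 0), (.inr 4, .inr 1)]

/-- An enumeration of the vertices of the Petersen graph. -/
def petersenRank : ZMod 5 ⊕ ZMod 5 → ℕ
  | .inl i => i.val
  | .inr i => 5 + i.val

lemma petersenRank_injective : Function.Injective petersenRank := by
  decide

lemma petersenEnds_adj : ∀ j, petersen.Adj (petersenEnds j).1 (petersenEnds j).2 := by
  decide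

/-- The edge with number `j` of the Petersen graph. -/
def petersenEdge (j : Fin 15) : petersen.edgeSet :=
  ⟨s((petersenEnds j).1, (petersenEnds j).2), petersenEnds_adj j⟩

lemma petersenEdge_injective : Function.Injective petersenEdge := by
  have : ∀ j k, s((petersenEnds j).1, (petersenEnds j).2) =
      s((petersenEnds k).1, (petersenEnds k).2) → j = k := by
    decide +kernel
  exact fun j k h ↦ this j k (congrArg Subtype.val h)

lemma petersenEdge_surjective : Function.Surjective petersenEdge := by
  have : ∀ a b, petersen.Adj a b →
      ∃ j, s((petersenEnds j).1, (petersenEnds j).2) = s(a, b) := by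
    decide +kernel
  rintro ⟨e, he⟩
  induction e with
  | _ a b =>
    obtain ⟨j, hj⟩ := this a b he
    exact ⟨j, Subtype.ext hj⟩

/-- The edges with numbers `j` and `k` of the Petersen graph are at distance one. -/
def PetersenDistOne (j k : Fin 15) : Prop :=
  (∀ u ∈ [(petersenEnds j).1, (petersenEnds j).2],
    ∀ v ∈ [(petersenEnds k).1, (petersenEnds k).2], u ≠ v) ∧
  ∃ u ∈ [(petersenEnds j).1, (petersenEnds j).2],
    ∃ v ∈ [(petersenEnds k).1, (petersenEnds k).2], petersen.Adj u v

instance : DecidableRel PetersenDistOne := fun j k ↦ by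
  unfold PetersenDistOne; infer_instance

lemma petersenDistOne_iff (j k : Fin 15) :
    PetersenDistOne j k ↔ edgeDist petersen (petersenEdge j) (petersenEdge k) = 1 := by
  rw [edgeDist_eq_one_iff]
  simp [PetersenDistOne, petersenEdge]

lemma petersenDistOne_symm {j k : Fin 15} (h : PetersenDistOne j k) : PetersenDistOne k j :=
  ⟨fun u hu v hv ↦ (h.1 v hv u hu).symm, by
    obtain ⟨u, hu, v, hv, huv⟩ := h.2
    exact ⟨v, hv, u, hu, huv.symm⟩⟩

lemma petersenDistOne_irrefl (j : Fin 15) : ¬ PetersenDistOne j j := fun h ↦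
  h.1 (petersenEnds j).1 (by simp) (petersenEnds j).1 (by simp) rfl

lemma sum_edgePairsAtDist_petersen {M : Type*} [AddCommMonoid M] (g : Sym2 petersen.edgeSet → M) :
    ∑ p ∈ edgePairsAtDist petersen 1, g p =
      ∑ p : Fin 15 × Fin 15 with p.1 < p.2 ∧ PetersenDistOne p.1 p.2,
        g s(petersenEdge p.1, petersenEdge p.2) := by
  symm
  refine Finset.sum_bij (fun p _ ↦ s(petersenEdge p.1, petersenEdge p.2)) ?_ ?_ ?_ fun _ _ ↦ rfl
  · rintro ⟨j, k⟩ hp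
    simp only [Finset.mem_filter, Finset.mem_univ, true_and] at hp
    rw [edgePairsAtDist, Finite.mem_toFinset]
    exact ⟨_, _, rfl, petersenEdge_injective.ne hp.1.ne, (petersenDistOne_iff j k).1 hp.2⟩
  · rintro ⟨j, k⟩ hp ⟨j', k'⟩ hp' heq
    simp only [Finset.mem_filter, Finset.mem_univ, true_and] at hp hp'
    simp only [Sym2.eq_iff, petersenEdge_injective.eq_iff] at heq
    rcases heq with ⟨rfl, rfl⟩ | ⟨rfl, rfl⟩
    · rfl
    · exact absurd hp.1 hp'.1.not_gt
  · intro p hp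
    rw [edgePairsAtDist, Finite.mem_toFinset] at hp
    obtain ⟨d, e, rfl, hne, hd⟩ := hp
    obtain ⟨j, rfl⟩ := petersenEdge_surjective d
    obtain ⟨k, rfl⟩ := petersenEdge_surjective e
    have hD := (petersenDistOne_iff j k).2 hd
    rcases lt_or_gt_of_ne (fun h : j = k ↦ hne (h ▸ rfl)) with hlt | hlt
    · exact ⟨(j, k), by simp [hlt, hD], rfl⟩
    · exact ⟨(k, j), by simp [hlt, petersenDistOne_symm hD], Sym2.eq_swap⟩

/-- Passing from unordered to ordered pairs allows the edge-vertex terms to be grouped by their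
edge. -/
lemma sum_lt_add_swap {M : Type*} [AddCommMonoid M] (g : Fin 15 → Fin 15 → M) :
    ∑ p : Fin 15 × Fin 15 with p.1 < p.2 ∧ PetersenDistOne p.1 p.2, (g p.1 p.2 + g p.2 p.1) =
      ∑ j, ∑ k with PetersenDistOne j k, g j k := by
  have hswap : ∑ p : Fin 15 × Fin 15 with p.1 < p.2 ∧ PetersenDistOne p.1 p.2, g p.2 p.1 =
      ∑ p : Fin 15 × Fin 15 with ¬ p.1 < p.2 ∧ PetersenDistOne p.1 p.2, g p.1 p.2 := by
    refine Finset.sum_nbij' Prod.swap Prod.swap ?_ ?_ (fun _ _ ↦ rfl) (fun _ _ ↦ rfl)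
      fun _ _ ↦ rfl
    · rintro ⟨j, k⟩ hp
      simp only [Finset.mem_filter, Finset.mem_univ, true_and] at hp ⊢
      exact ⟨hp.1.not_gt, petersenDistOne_symm hp.2⟩
    · rintro ⟨j, k⟩ hp
      simp only [Finset.mem_filter, Finset.mem_univ, true_and] at hp ⊢
      refine ⟨lt_of_le_of_ne (not_lt.1 hp.1) fun h : k = j ↦ ?_, petersenDistOne_symm hp.2⟩
      exact petersenDistOne_irrefl _ (h ▸ hp.2)
  rw [Finset.sum_add_distrib, hswap]
  simp only [← Finset.filter_filter, and_comm (b := PetersenDistOne _ _)]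
  rw [Finset.sum_filter_add_sum_filter_not, Finset.sum_filter, Fintype.sum_prod_type]
  simp only [Finset.sum_filter]

/-- Every vertex is an end point of an even number of the edges at distance one from a given
edge. -/
lemma sum_petersenDistOne_ends (j : Fin 15) (g : ZMod 5 ⊕ ZMod 5 → ZMod 2) :
    ∑ k with PetersenDistOne j k, (g (petersenEnds k).1 + g (petersenEnds k).2) = 0 := by
  -- The number is 2 for each vertex not on edge j and 0 for its two ends. A neighbour of an end has
  -- two further edges, and a vertex at distance 2 from both ends has exactly one common neighbour
  -- with each.
  have heven : ∀ (j : Fin 15) (v : ZMod 5 ⊕ ZMod 5), ∑ k with PetersenDistOne j k,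
      ((if (petersenEnds k).1 = v then 1 else 0) + (if (petersenEnds k).2 = v then 1 else 0)
        : ZMod 2) = 0 := by
    decide +kernel
  have hg : ∀ w, g w = ∑ v, g v * (if w = v then 1 else 0) := fun w ↦ by simp
  calc ∑ k with PetersenDistOne j k, (g (petersenEnds k).1 + g (petersenEnds k).2)
      = ∑ k with PetersenDistOne j k, ∑ v, g v * ((if (petersenEnds k).1 = v then 1 else 0) +
          (if (petersenEnds k).2 = v then 1 else 0)) := by
        refine Finset.sum_congr rfl fun k _ ↦ ?_
        simp only [mul_add, Finset.sum_add_distrib, ← hg]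
    _ = 0 := by
        rw [Finset.sum_comm]
        simp only [← Finset.mul_sum, heven, mul_zero, Finset.sum_const_zero]

/-- The cyclic sequence a, c, b, d has an odd number of descents exactly if {a, b} and {c, d}
interleave, that is, if the chords ab and cd cross when the vertices lie on a circle in the order of
`petersenRank`. -/
lemma sum_descents_petersen :
    ∑ p : Fin 15 × Fin 15 with p.1 < p.2 ∧ PetersenDistOne p.1 p.2,
      (((if petersenRank (petersenEnds p.1).2 < petersenRank (petersenEnds p.2).1 then 1 else 0) +
        (if petersenRank (petersenEnds p.2).2 < petersenRank (petersenEnds p.1).2 then 1 else 0) +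
        (if petersenRank (petersenEnds p.1).1 < petersenRank (petersenEnds p.2).2 then 1 else 0) +
        (if petersenRank (petersenEnds p.2).1 < petersenRank (petersenEnds p.1).1 then 1 else 0)
          : ℕ) : ZMod 2) = 1 := by
  decide +kernel

/-- In a plane generic immersion of the Petersen graph, the number of crossings between edges at
distance one is odd. -/
theorem odd_sum_crossingCount_petersen {f : realization petersen → Plane}
    (hf : IsPlaneGenericImmersion f) :
    Odd (∑ p ∈ edgePairsAtDist petersen 1, crossingCount f p) := by
  obtain ⟨n, hn⟩ := hf.exists_crossing_parity petersenRank petersenRank_injective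
  rw [← ZMod.natCast_eq_one_iff_odd, sum_edgePairsAtDist_petersen, Nat.cast_sum]
  have hterm : ∀ p ∈ Finset.univ.filter fun p : Fin 15 × Fin 15 ↦
      p.1 < p.2 ∧ PetersenDistOne p.1 p.2, _ := fun p hp ↦ by
    have hD := (Finset.mem_filter.1 hp).2.2.1
    exact hn _ _ _ _ (petersenEnds_adj p.1) (petersenEnds_adj p.2)
      (hD _ (by simp) _ (by simp)) (hD _ (by simp) _ (by simp))
      (hD _ (by simp) _ (by simp)) (hD _ (by simp) _ (by simp))
  refine (Finset.sum_congr rfl hterm).trans ?_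
  rw [Finset.sum_add_distrib, sum_descents_petersen]
  have := sum_lt_add_swap fun j k ↦
    n (petersenEnds j).1 (petersenEnds j).2 (petersenEnds k).1 +
      n (petersenEnds j).1 (petersenEnds j).2 (petersenEnds k).2
  rw [this, Finset.sum_eq_zero fun j _ ↦ sum_petersenDistOne_ends j _, zero_add]

end PlaneGraph

theorem theorem1p3 (f : PlaneGraph.realization PlaneGraph.petersen → PlaneGraph.Plane)
    (hf : PlaneGraph.IsPlaneGenericImmersion f) :
    Odd (∑ p ∈ PlaneGraph.edgePairsAtDist PlaneGraph.petersen 1,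
      PlaneGraph.crossingCount f p) := by
  exact PlaneGraph.odd_sum_crossingCount_petersen hf
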